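/- For integers $a\ge 1$ and $b\ge 0$ let ${}^{0}a=1$ and ${}^{b+1}a=a^{({}^{b}a)}$ (integer tetration). For $a\ge 2$ not a multiple of $10$ and $b\ge 1$, the congruence speed $V(a,b)$ is the nonnegative integer $v$ such that, for some $d\ge 0$, ${}^{b-1}a$ and ${}^{b}a$ are congruent modulo $10^{d}$ but not modulo $10^{d+1}$, while ${}^{b}a$ and ${}^{b+1}a$ are congruent modulo $10^{d+v}$ but not modulo $10^{d+v+1}$. The constant congruence speed $V(a)$ is the common value of $V(a,b)$ for all sufficiently large $b$; by convention $V(1)=0$. For $n\ge 0$ let $\tilde a(n)$ be the smallest positive integer $a\not\equiv 0\pmod{10}$ with $V(a)=n$. **Theorem 1.** For every integer $n\ge 2$, $\tilde a(n)$ exists and $$\tilde a(n)=\begin{cases}2^n\left(5+2\sin\frac{\pi n}{2}+4\cos\frac{\pi n}{2}\right)+1 & \text{if and only if } n\equiv 2,3 \pmod 4,\\[4pt] 2^n\left(5-2\sin\frac{\pi n}{2}-4\cos\frac{\pi n}{2}\right)-1 & \text{if and only if } n\equiv 0,1 \pmod 4,\end{cases}$$ and $\tilde a(n)\equiv 5\pmod{10}$.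 Moreover $\tilde a(1)=2$, and $a=1$ is the only positive integer $a\not\equiv 0\pmod{10}$ with $V(a)=0$; in particular $\tilde a(0)=1$. -/

import Mathlib

open Filter

/-- Integer tetration: `tower a b` is the power tower of height `b` with base `a`
(so `tower a 1 = a` and `tower a (b + 1) = a ^ tower a b`). -/
def tower (a : ℕ) : ℕ → ℕ
  | 0 => 1
  | b + 1 => a ^ tower a b

/-- `x` and `y` are congruent modulo `10 ^ d` but not modulo `10 ^ (d + 1)`: in radix `10` they agree
on exactly their `d` rightmost digits. -/
def AgreeExactly (x y d : ℕ) : Prop :=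
  x ≡ y [MOD 10 ^ d] ∧ ¬ x ≡ y [MOD 10 ^ (d + 1)]

/-- The congruence speed `V(a, b)` of the base `a` at height `b ≥ 1` is `v`: the towers of heights
`b - 1` and `b` agree on exactly `d` digits, those of heights `b` and `b + 1` on exactly `d + v`. -/
def IsCongruenceSpeedAt (a b v : ℕ) : Prop :=
  1 ≤ b ∧ ∃ d : ℕ, AgreeExactly (tower a (b - 1)) (tower a b) d ∧
    AgreeExactly (tower a b) (tower a (b + 1)) (d + v)

/-- The constant congruence speed `V(a)` of the base `a` is `v`: by convention `V(1) = 0`, and for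
`a ≥ 2` it is the common value of `V(a, b)` for all sufficiently large heights `b`. -/
def IsConstantCongruenceSpeed (a v : ℕ) : Prop :=
  (a = 1 ∧ v = 0) ∨ (2 ≤ a ∧ ∀ᶠ b in atTop, IsCongruenceSpeedAt a b v)

/-- The bases, not multiples of `10`, whose constant congruence speed equals `n`. -/
def basesOfSpeed (n : ℕ) : Set ℕ :=
  {a | ¬ a ≡ 0 [MOD 10] ∧ IsConstantCongruenceSpeed a n}

/-!
The towers of heights `b` and `b + 1` over `a` agree on exactly `min v₂ v₅` decimal digits, where
`v₂`, `v₅` are the valuations of their difference `g b`. As `g (b + 1) = a ^ tower a b *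
(a ^ g b - 1)` and `4 ∣ g b` for `b ≥ 2`, lifting the exponent gives, for large `b`, that `v₅`
grows by exactly `v₅ (a ^ 4 - 1)` at each step if `5 ∤ a`, and `v₂` by exactly
`v₂ (a ^ 2 - 1) - 1` if `a` is odd (`padicValNat_five_towerGap`, `padicValNat_two_towerGap`). At a
prime dividing `a` the valuation grows at least exponentially and does not influence the minimum
(`eventually_le_padicValNat_towerGap`). Hence the constant congruence speed is
* `v₂ (a ^ 2 - 1) - 1` for `a` an odd multiple of `5`,
* `v₅ (a ^ 4 - 1)` for `a` even and not a multiple of `5`,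
* the minimum of the two for `a` prime to `10`,

and in particular it is positive for `a ≥ 2`.

For `n ≥ 2`, an odd multiple of `5` has speed `n` if and only if it is `k * 2 ^ n ± 1` with `k` odd.
The powers of `2` modulo `5` have period `4`, and they show that the least such base has `k = 1` for
even `n` and `k = 3` for odd `n`. A base of speed `n` that is not divisible by `5` satisfies
`5 ^ n ∣ a ^ 4 - 1`, so `5 ^ n` divides `a - 1`, `a + 1` or `a ^ 2 + 1` (`five_pow_dvd_factor`).
Since `5 ^ n` outgrows `(2 ^ n) ^ 2`, such a base is larger than the least odd multiple of `5`, up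
to a few small `n` in the case of `a ^ 2 + 1` that are checked separately
(`two_pow_lt_of_five_pow_dvd`, `three_mul_two_pow_lt_of_five_pow_dvd`).
-/

instance fact_prime_five : Fact (Nat.Prime 5) := ⟨Nat.prime_five⟩

/-- The difference of two consecutive towers over `a`, of heights `b` and `b + 1`. The towers
increase with `b` for `a ≥ 2`, so that the subtraction does not truncate. -/
def towerGap (a b : ℕ) : ℕ := tower a (b + 1) - tower a b

/-- The number of rightmost decimal digits on which the towers over `a ≥ 2` of heights `b` and
`b + 1` agree, as the smaller of the `2`-adic and `5`-adic valuations of their difference. -/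
def agreement (a b : ℕ) : ℕ :=
  min (padicValNat 2 (towerGap a b)) (padicValNat 5 (towerGap a b))

/-! ### Towers and their differences -/

lemma lt_tower {a : ℕ} (ha : 2 ≤ a) (b : ℕ) : b < tower a b := by
  induction b with
  | zero => simp [tower]
  | succ b ih =>
    have : tower a b < tower a (b + 1) := Nat.lt_pow_self (by omega)
    omega

lemma tower_lt_tower_succ {a : ℕ} (ha : 2 ≤ a) (b : ℕ) : tower a b < tower a (b + 1) :=
  Nat.lt_pow_self (by omega)

lemma two_pow_le_tower {a : ℕ} (ha : 2 ≤ a) (b : ℕ) : 2 ^ b ≤ tower a b := by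
  cases b with
  | zero => simp [tower]
  | succ b =>
    calc 2 ^ (b + 1) ≤ 2 ^ tower a b := Nat.pow_le_pow_right (by norm_num) (lt_tower ha b)
      _ ≤ tower a (b + 1) := Nat.pow_le_pow_left ha _

lemma towerGap_ne_zero {a : ℕ} (ha : 2 ≤ a) (b : ℕ) : towerGap a b ≠ 0 :=
  (Nat.sub_pos_of_lt (tower_lt_tower_succ ha b)).ne'

lemma towerGap_succ {a : ℕ} (ha : 2 ≤ a) (b : ℕ) :
    towerGap a (b + 1) = a ^ tower a b * (a ^ towerGap a b - 1) := by
  have h := tower_lt_tower_succ ha b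
  have e : tower a (b + 1) = tower a b + towerGap a b := by unfold towerGap; omega
  change a ^ tower a (b + 1) - a ^ tower a b = _
  rw [e, pow_add, Nat.mul_sub, mul_one]

lemma four_dvd_towerGap {a : ℕ} (ha : 2 ≤ a) (b : ℕ) : 4 ∣ towerGap a (b + 2) := by
  rcases Nat.even_or_odd a with h | h
  · have hdvd : 4 ∣ a ^ tower a (b + 1) :=
      (pow_dvd_pow_of_dvd h.two_dvd 2).trans
        (pow_dvd_pow a (by have := lt_tower ha (b + 1); omega))
    rw [towerGap_succ ha]
    exact hdvd.mul_right _
  · have hodd (c : ℕ) : Odd (tower a c) := by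
      cases c with
      | zero => simp [tower]
      | succ c => exact h.pow
    have heven : 2 ∣ towerGap a (b + 1) := (Nat.Odd.sub_odd (hodd _) (hodd _)).two_dvd
    obtain ⟨c, hc⟩ := heven
    rw [towerGap_succ ha, hc, pow_mul]
    have h8 : 4 ∣ a ^ 2 - 1 := (by norm_num : 4 ∣ 8).trans (Nat.eight_dvd_sq_sub_one_of_odd h)
    have := Nat.sub_dvd_pow_sub_pow (a ^ 2) 1 c
    rw [one_pow] at this
    exact (h8.trans this).mul_left _

/-! ### Valuations of the differences -/

lemma padicValNat_towerGap_succ {a p : ℕ} [Fact p.Prime] (ha : 2 ≤ a) (hp : ¬ p ∣ a) (b : ℕ) :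
    padicValNat p (towerGap a (b + 1)) = padicValNat p (a ^ towerGap a b - 1) := by
  have h1 : 1 < a ^ towerGap a b := Nat.one_lt_pow (towerGap_ne_zero ha b) (by omega)
  rw [towerGap_succ ha, padicValNat.mul (by positivity) (by omega),
    padicValNat.eq_zero_of_not_dvd (fun h => hp (Fact.out (p := p.Prime).dvd_of_dvd_pow h)),
    zero_add]

lemma padicValNat_five_towerGap {a : ℕ} (ha : 2 ≤ a) (h5 : ¬ 5 ∣ a) :
    ∀ᶠ b in atTop, padicValNat 5 (towerGap a (b + 1)) =
      padicValNat 5 (towerGap a b) + padicValNat 5 (a ^ 4 - 1) := by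
  filter_upwards [eventually_ge_atTop 2] with b hb
  obtain ⟨c, rfl⟩ := Nat.exists_eq_add_of_le' hb
  obtain ⟨q, hq⟩ := four_dvd_towerGap ha c
  have hq0 : q ≠ 0 := by
    rintro rfl
    exact towerGap_ne_zero ha _ hq
  have h4 : 5 ∣ a ^ 4 - 1 :=
    (Nat.modEq_iff_dvd' (Nat.one_le_pow _ _ (by omega))).1
      (Nat.ModEq.pow_totient ((Nat.Prime.coprime_iff_not_dvd Nat.prime_five).2 h5).symm).symm
  have := padicValNat.pow_sub_pow (p := 5) (x := a ^ 4) (y := 1) (by decide)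
    (Nat.one_lt_pow (by norm_num) (by omega)) h4
    (fun h => h5 (Nat.prime_five.dvd_of_dvd_pow h)) hq0
  rw [padicValNat_towerGap_succ ha h5, hq, pow_mul, padicValNat.mul (by norm_num) hq0,
    padicValNat.eq_zero_of_not_dvd (by norm_num : ¬ 5 ∣ 4)]
  rw [one_pow] at this
  omega

lemma padicValNat_two_towerGap {a s : ℕ} (ha : 2 ≤ a) (h2 : ¬ 2 ∣ a)
    (hs : padicValNat 2 (a ^ 2 - 1) = s + 1) :
    ∀ᶠ b in atTop, padicValNat 2 (towerGap a (b + 1)) = padicValNat 2 (towerGap a b) + s := by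
  filter_upwards [eventually_ge_atTop 2] with b hb
  obtain ⟨c, rfl⟩ := Nat.exists_eq_add_of_le' hb
  have heven : Even (towerGap a (c + 2)) :=
    even_iff_two_dvd.2 ((by norm_num : 2 ∣ 4).trans (four_dvd_towerGap ha c))
  have := padicValNat.pow_two_sub_pow (x := a) (y := 1) (by omega) (by omega) h2
    (towerGap_ne_zero ha _) heven
  have hsq : a ^ 2 - 1 = (a + 1) * (a - 1) := by simpa using Nat.sq_sub_sq a 1
  rw [hsq, padicValNat.mul (by omega) (by omega)] at hs
  rw [padicValNat_towerGap_succ ha h2]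
  rw [one_pow] at this
  omega

/-- At a prime dividing the base, the valuation of the differences grows at least exponentially
in the height, so it eventually exceeds every sequence with constant increments. -/
lemma eventually_le_padicValNat_towerGap {a p s : ℕ} [Fact p.Prime] (ha : 2 ≤ a) (hp : p ∣ a)
    {u : ℕ → ℕ} (hu : ∀ᶠ b in atTop, u (b + 1) = u b + s) :
    ∀ᶠ b in atTop, u b ≤ padicValNat p (towerGap a b) := by
  obtain ⟨N, hN⟩ := eventually_atTop.1 hu
  have hlin (k : ℕ) : u (N + k) = u N + s * k := by
    induction k with
    | zero => simp
    | succ k ih => rw [← add_assoc, hN _ (by omega), ih]; ring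
  have hval (b : ℕ) : 2 ^ b ≤ padicValNat p (towerGap a (b + 1)) := by
    refine (two_pow_le_tower ha b).trans ?_
    rw [← padicValNat_dvd_iff_le (towerGap_ne_zero ha _), towerGap_succ ha]
    exact (pow_dvd_pow_of_dvd hp _).mul_right _
  have hexp : ∀ᶠ b : ℕ in atTop, (u N + s + s) * b ≤ 2 ^ b := by
    have h := (isLittleO_coe_const_pow_of_one_lt (R := ℝ) (r := 2) (by norm_num)).bound
      (c := 1 / (u N + s + s + 1)) (by positivity)
    filter_upwards [h] with b hb
    rw [Real.norm_of_nonneg (by positivity), Real.norm_of_nonneg (by positivity), one_div,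
      ← div_eq_inv_mul, le_div_iff₀ (by positivity)] at hb
    have : b * (u N + s + s + 1) ≤ 2 ^ b := by exact_mod_cast hb
    nlinarith
  obtain ⟨M, hM⟩ := eventually_atTop.1 hexp
  filter_upwards [eventually_ge_atTop (N + M + 2)] with b hb
  obtain ⟨c, rfl⟩ := Nat.exists_eq_add_of_le' (show 1 ≤ b by omega)
  refine le_trans ?_ (hval c)
  refine le_trans ?_ (hM c (by omega))
  obtain ⟨k, hk⟩ := Nat.exists_eq_add_of_le (show N ≤ c + 1 by omega)
  rw [hk, hlin]
  have h1 : k ≤ 2 * c := by omega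
  have h2 : 1 ≤ c := by omega
  nlinarith [Nat.mul_le_mul_left s h1, Nat.mul_le_mul_left (u N) h2]

/-! ### The constant congruence speed -/

lemma agreeExactly_iff {x y d : ℕ} (h : x < y) :
    AgreeExactly x y d ↔ d = min (padicValNat 2 (y - x)) (padicValNat 5 (y - x)) := by
  have h0 : y - x ≠ 0 := by omega
  have key (k : ℕ) : x ≡ y [MOD 10 ^ k] ↔
      k ≤ padicValNat 2 (y - x) ∧ k ≤ padicValNat 5 (y - x) := by
    have hc : Nat.Coprime (2 ^ k) (5 ^ k) := Nat.Coprime.pow _ _ (by norm_num)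
    rw [Nat.modEq_iff_dvd' h.le, ← padicValNat_dvd_iff_le h0, ← padicValNat_dvd_iff_le h0,
      show 10 ^ k = 2 ^ k * 5 ^ k from Nat.mul_pow 2 5 k]
    exact ⟨fun h => ⟨dvd_of_mul_right_dvd h, dvd_of_mul_left_dvd h⟩,
      fun h => hc.mul_dvd_of_dvd_of_dvd h.1 h.2⟩
  rw [AgreeExactly, key, key]
  omega

lemma isConstantCongruenceSpeed_iff {a v : ℕ} (ha : 2 ≤ a) :
    IsConstantCongruenceSpeed a v ↔ ∀ᶠ b in atTop, agreement a (b + 1) = agreement a b + v := by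
  have key (b : ℕ) :
      IsCongruenceSpeedAt a (b + 1) v ↔ agreement a (b + 1) = agreement a b + v := by
    have e := fun b d => agreeExactly_iff (d := d) (tower_lt_tower_succ ha b)
    simp only [IsCongruenceSpeedAt, Nat.add_sub_cancel, e]
    change (1 ≤ b + 1 ∧ ∃ d, d = agreement a b ∧ d + v = agreement a (b + 1)) ↔ _
    constructor
    · rintro ⟨-, d, rfl, h⟩
      exact h.symm
    · exact fun h => ⟨by omega, _, rfl, h.symm⟩
  rw [IsConstantCongruenceSpeed, or_iff_right (by omega), and_iff_right ha,
    ← eventually_congr (Eventually.of_forall key)]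
  conv_lhs => rw [← map_add_atTop_eq_nat 1, eventually_map]

lemma IsConstantCongruenceSpeed.unique {a v w : ℕ} (hv : IsConstantCongruenceSpeed a v)
    (hw : IsConstantCongruenceSpeed a w) : v = w := by
  rcases hv with ⟨rfl, rfl⟩ | hv
  · rcases hw with ⟨-, rfl⟩ | hw
    · rfl
    · omega
  · have hw' := (isConstantCongruenceSpeed_iff hv.1).1 hw
    have hv' := (isConstantCongruenceSpeed_iff hv.1).1 (Or.inr hv)
    obtain ⟨b, h1, h2⟩ := (hv'.and hw').exists
    omega

lemma eventually_min_succ {u w : ℕ → ℕ} {s t : ℕ} (hu : ∀ᶠ b in atTop, u (b + 1) = u b + s)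
    (hw : ∀ᶠ b in atTop, w (b + 1) = w b + t) (hst : s ≤ t) :
    ∀ᶠ b in atTop, min (u (b + 1)) (w (b + 1)) = min (u b) (w b) + s := by
  obtain ⟨N, hN⟩ := eventually_atTop.1 (hu.and hw)
  rcases hst.eq_or_lt with rfl | hst
  · filter_upwards [hu, hw] with b h1 h2
    omega
  · have hlin (k : ℕ) : u (N + k) + k ≤ u N + w (N + k) := by
      induction k with
      | zero => simp
      | succ k ih =>
        have := hN (N + k) (by omega)
        rw [← add_assoc N k 1]
        omega
    filter_upwards [eventually_ge_atTop (N + u N)] with b hb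
    obtain ⟨k, rfl⟩ := Nat.exists_eq_add_of_le (show N ≤ b by omega)
    have := hlin k
    have := hN (N + k) (by omega)
    omega

/-- For a base prime to `10` both valuations grow linearly, and the slower one decides. -/
lemma isConstantCongruenceSpeed_of_coprime {a s : ℕ} (ha : 2 ≤ a) (h2 : ¬ 2 ∣ a) (h5 : ¬ 5 ∣ a)
    (hs : padicValNat 2 (a ^ 2 - 1) = s + 1) :
    IsConstantCongruenceSpeed a (min s (padicValNat 5 (a ^ 4 - 1))) := by
  rw [isConstantCongruenceSpeed_iff ha]
  have hu := padicValNat_two_towerGap ha h2 hs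
  have hw := padicValNat_five_towerGap ha h5
  rcases le_total s (padicValNat 5 (a ^ 4 - 1)) with h | h
  · rw [min_eq_left h]
    exact eventually_min_succ (u := fun b => padicValNat 2 (towerGap a b))
      (w := fun b => padicValNat 5 (towerGap a b)) hu hw h
  · rw [min_eq_right h]
    simpa only [agreement, min_comm] using
      eventually_min_succ (u := fun b => padicValNat 5 (towerGap a b))
        (w := fun b => padicValNat 2 (towerGap a b)) hw hu h

lemma isConstantCongruenceSpeed_of_two_dvd {a : ℕ} (ha : 2 ≤ a) (h2 : 2 ∣ a) (h5 : ¬ 5 ∣ a) :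
    IsConstantCongruenceSpeed a (padicValNat 5 (a ^ 4 - 1)) := by
  rw [isConstantCongruenceSpeed_iff ha]
  have hw := padicValNat_five_towerGap ha h5
  have hle := eventually_le_padicValNat_towerGap ha h2
    (u := fun b => padicValNat 5 (towerGap a b)) hw
  filter_upwards [hw, hle, (tendsto_add_atTop_nat 1).eventually hle] with b e1 e2 e3
  rw [agreement, agreement, min_eq_right e2, min_eq_right e3, e1]

lemma isConstantCongruenceSpeed_of_five_dvd {a s : ℕ} (ha : 2 ≤ a) (h2 : ¬ 2 ∣ a) (h5 : 5 ∣ a)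
    (hs : padicValNat 2 (a ^ 2 - 1) = s + 1) : IsConstantCongruenceSpeed a s := by
  rw [isConstantCongruenceSpeed_iff ha]
  have hu := padicValNat_two_towerGap ha h2 hs
  have hle := eventually_le_padicValNat_towerGap ha h5
    (u := fun b => padicValNat 2 (towerGap a b)) hu
  filter_upwards [hu, hle, (tendsto_add_atTop_nat 1).eventually hle] with b e1 e2 e3
  rw [agreement, agreement, min_eq_left e2, min_eq_left e3, e1]

lemma one_le_padicValNat_five {a : ℕ} (ha : 2 ≤ a) (h5 : ¬ 5 ∣ a) :
    1 ≤ padicValNat 5 (a ^ 4 - 1) := by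
  have h1 : 1 < a ^ 4 := Nat.one_lt_pow (by norm_num) (by omega)
  rw [← padicValNat_dvd_iff_le (by omega), pow_one]
  exact (Nat.modEq_iff_dvd' h1.le).1
    (Nat.ModEq.pow_totient ((Nat.Prime.coprime_iff_not_dvd Nat.prime_five).2 h5).symm).symm

lemma exists_padicValNat_two {a : ℕ} (ha : 2 ≤ a) (h2 : ¬ 2 ∣ a) :
    ∃ s, 1 ≤ s ∧ padicValNat 2 (a ^ 2 - 1) = s + 1 := by
  have h1 : 1 < a ^ 2 := Nat.one_lt_pow (by norm_num) (by omega)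
  have : 2 ≤ padicValNat 2 (a ^ 2 - 1) := by
    rw [← padicValNat_dvd_iff_le (by omega)]
    exact (by norm_num : 2 ^ 2 ∣ 8).trans
      (Nat.eight_dvd_sq_sub_one_of_odd (Nat.odd_iff.2 (by omega)))
  exact ⟨padicValNat 2 (a ^ 2 - 1) - 1, by omega, by omega⟩

lemma IsConstantCongruenceSpeed.ne_zero {a v : ℕ} (ha : 2 ≤ a) (h10 : ¬ a ≡ 0 [MOD 10])
    (hv : IsConstantCongruenceSpeed a v) : v ≠ 0 := by
  have h10' : ¬ (2 ∣ a ∧ 5 ∣ a) := by unfold Nat.ModEq at h10; omega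
  by_cases h2 : 2 ∣ a
  · have h5 : ¬ 5 ∣ a := fun h => h10' ⟨h2, h⟩
    have := hv.unique (isConstantCongruenceSpeed_of_two_dvd ha h2 h5)
    have := one_le_padicValNat_five ha h5
    omega
  · obtain ⟨s, hs1, hs⟩ := exists_padicValNat_two ha h2
    by_cases h5 : 5 ∣ a
    · have := hv.unique (isConstantCongruenceSpeed_of_five_dvd ha h2 h5 hs)
      omega
    · have := hv.unique (isConstantCongruenceSpeed_of_coprime ha h2 h5 hs)
      have := one_le_padicValNat_five ha h5
      omega

/-! ### Bases not divisible by five -/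

/-- The factors of `a ^ 4 - 1 = (a - 1) * (a + 1) * (a ^ 2 + 1)` are pairwise coprime away from
`2`, so a power of `5` dividing the product divides one of them. -/
lemma five_pow_dvd_factor {a n : ℕ} (ha : 1 ≤ a) (h : 5 ^ n ∣ a ^ 4 - 1) :
    5 ^ n ∣ a - 1 ∨ 5 ^ n ∣ a + 1 ∨ 5 ^ n ∣ a ^ 2 + 1 := by
  obtain ⟨c, rfl⟩ := Nat.exists_eq_add_of_le' ha
  have e : (c + 1) ^ 4 - 1 = c * ((c + 1 + 1) * ((c + 1) ^ 2 + 1)) := by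
    apply Nat.sub_eq_of_eq_add
    ring
  rw [e] at h
  rw [Nat.add_sub_cancel]
  have hcop {m : ℕ} (hm : ¬ 5 ∣ m) : Nat.Coprime (5 ^ n) m :=
    ((Nat.Prime.coprime_iff_not_dvd Nat.prime_five).2 hm).pow_left _
  have hsq : (c + 1) ^ 2 + 1 = c * (c + 2) + 2 := by ring
  by_cases h1 : 5 ∣ c
  · have h3 : ¬ 5 ∣ (c + 1) ^ 2 + 1 := by
      have := h1.mul_right (c + 2)
      omega
    exact Or.inl ((hcop (Nat.prime_five.not_dvd_mul (by omega) h3)).dvd_of_dvd_mul_right h)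
  · have h' := (hcop h1).dvd_of_dvd_mul_left h
    by_cases h2 : 5 ∣ c + 2
    · have h3 : ¬ 5 ∣ (c + 1) ^ 2 + 1 := by
        have := h2.mul_left c
        omega
      exact Or.inr (Or.inl ((hcop h3).dvd_of_dvd_mul_right h'))
    · exact Or.inr (Or.inr ((hcop h2).dvd_of_dvd_mul_left h'))

lemma five_pow_dvd_of_speed {a n : ℕ} (ha : 2 ≤ a) (h5 : ¬ 5 ∣ a)
    (hv : IsConstantCongruenceSpeed a n) : 5 ^ n ∣ a ^ 4 - 1 := by
  have h1 : 1 < a ^ 4 := Nat.one_lt_pow (by norm_num) (by omega)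
  rw [padicValNat_dvd_iff_le (by omega)]
  by_cases h2 : 2 ∣ a
  · exact (hv.unique (isConstantCongruenceSpeed_of_two_dvd ha h2 h5)).le
  · obtain ⟨s, -, hs⟩ := exists_padicValNat_two ha h2
    have := hv.unique (isConstantCongruenceSpeed_of_coprime ha h2 h5 hs)
    omega

lemma two_pow_lt_of_five_pow_dvd {a n : ℕ} (hn : 2 ≤ n) (ha : 2 ≤ a) (h : 5 ^ n ∣ a ^ 4 - 1) :
    2 ^ n < a := by
  have h45 : 4 ^ n + 9 ≤ 5 ^ n := by
    induction n, hn using Nat.le_induction with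
    | base => norm_num
    | succ n hn ih => rw [pow_succ, pow_succ]; have := ih ((pow_dvd_pow 5 n.le_succ).trans h); omega
  have h24 : 2 ^ n ≤ 4 ^ n := Nat.pow_le_pow_left (by norm_num) n
  have hsq : 4 ^ n = (2 ^ n) ^ 2 := (Nat.pow_right_comm 2 2 n)
  rcases five_pow_dvd_factor (by omega) h with h | h | h
  · have := Nat.le_of_dvd (by omega) h
    omega
  · have := Nat.le_of_dvd (by omega) h
    omega
  · have := Nat.le_of_dvd (by omega) h
    exact lt_of_pow_lt_pow_left₀ 2 (by omega) (by omega)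

/-- The size bound `9 * 4 ^ n + 1 < 5 ^ n` holds only from `n = 10` on; below, a solution of
`a ^ 2 ≡ -1` modulo `5 ^ n` is excluded by inspection of the few possible quotients. -/
lemma three_mul_two_pow_lt_of_five_pow_dvd {a n : ℕ} (hn : 2 ≤ n) (hodd : n % 2 = 1) (ha : 2 ≤ a)
    (h : 5 ^ n ∣ a ^ 4 - 1) : 3 * 2 ^ n < a := by
  have h35 : 3 * 2 ^ n + 2 ≤ 5 ^ n := by
    have h3 : 3 ≤ n := by omega
    clear * - h3
    induction n, h3 using Nat.le_induction with
    | base => norm_num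
    | succ n hn ih => rw [pow_succ, pow_succ]; omega
  rcases five_pow_dvd_factor (by omega) h with h | h | h
  · have := Nat.le_of_dvd (by omega) h
    omega
  · have := Nat.le_of_dvd (by omega) h
    omega
  · by_contra! hle
    by_cases h10 : 10 ≤ n
    · have h45 : 9 * 4 ^ n + 2 ≤ 5 ^ n := by
        clear * - h10
        induction n, h10 using Nat.le_induction with
        | base => norm_num
        | succ n hn ih => rw [pow_succ, pow_succ]; omega
      have hsq : 4 ^ n = (2 ^ n) ^ 2 := (Nat.pow_right_comm 2 2 n)
      have := Nat.le_of_dvd (by omega) h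
      have := Nat.pow_le_pow_left hle 2
      rw [mul_pow] at this
      omega
    · obtain ⟨q, hq⟩ := h
      have hub := Nat.pow_le_pow_left hle 2
      have hns {m : ℕ} (k : ℕ) (h1 : k ^ 2 < m) (h2 : m < (k + 1) ^ 2) : a ^ 2 ≠ m := by
        rintro rfl
        have := lt_of_pow_lt_pow_left₀ 2 (by omega) h1
        have := lt_of_pow_lt_pow_left₀ 2 (by omega) h2
        omega
      have : n = 3 ∨ n = 5 ∨ n = 7 ∨ n = 9 := by omega
      rcases this with rfl | rfl | rfl | rfl
      · have : q = 1 ∨ q = 2 ∨ q = 3 ∨ q = 4 := by omega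
        have := hns (m := 124) 11 (by norm_num) (by norm_num)
        have := hns (m := 249) 15 (by norm_num) (by norm_num)
        have := hns (m := 374) 19 (by norm_num) (by norm_num)
        have := hns (m := 499) 22 (by norm_num) (by norm_num)
        omega
      · have : q = 1 ∨ q = 2 := by omega
        have := hns (m := 3124) 55 (by norm_num) (by norm_num)
        have := hns (m := 6249) 79 (by norm_num) (by norm_num)
        omega
      · have := hns (m := 78124) 279 (by norm_num) (by norm_num)
        omega
      · have := hns (m := 1953124) 1397 (by norm_num) (by norm_num)
        omega

/-! ### Odd multiples of five -/

lemma padicValNat_two_mul_two_pow {k : ℕ} (hk : k % 2 = 1) (n : ℕ) :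
    padicValNat 2 (k * 2 ^ n) = n := by
  rw [padicValNat.mul (by omega) (by positivity), padicValNat.prime_pow,
    padicValNat.eq_zero_of_not_dvd (by omega), zero_add]

lemma padicValNat_two_sq_sub_one {a : ℕ} (ha : 2 ≤ a) :
    padicValNat 2 (a ^ 2 - 1) = padicValNat 2 (a + 1) + padicValNat 2 (a - 1) := by
  have hsq : a ^ 2 - 1 = (a + 1) * (a - 1) := by simpa using Nat.sq_sub_sq a 1
  rw [hsq, padicValNat.mul (by omega) (by omega)]

lemma padicValNat_two_eq_one {m : ℕ} (h : m % 4 = 2) : padicValNat 2 m = 1 := by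
  have := padicValNat_two_mul_two_pow (k := m / 2) (by omega) 1
  rwa [pow_one, Nat.div_mul_cancel (by omega)] at this

lemma exists_odd_mul_two_pow {m n : ℕ} (hm : m ≠ 0) (h : padicValNat 2 m = n) :
    ∃ k, k % 2 = 1 ∧ m = k * 2 ^ n := by
  obtain ⟨k, hk⟩ := (padicValNat_dvd_iff_le hm).2 h.ge
  refine ⟨k, ?_, by rw [hk, mul_comm]⟩
  by_contra hodd
  have : 2 ^ (n + 1) ∣ m := by
    rw [hk, pow_succ]
    exact mul_dvd_mul_left _ (by omega)
  have := (padicValNat_dvd_iff_le hm).1 this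
  omega

/-- One of the two even numbers `a - 1` and `a + 1` has `2`-adic valuation `1`, so the other one
carries the rest of the valuation of `a ^ 2 - 1`. -/
lemma padicValNat_two_sq_sub_one_eq_iff {a n : ℕ} (hn : 2 ≤ n) (ha : 2 ≤ a) (h2 : ¬ 2 ∣ a) :
    padicValNat 2 (a ^ 2 - 1) = n + 1 ↔
      ∃ k, k % 2 = 1 ∧ (a = k * 2 ^ n + 1 ∨ a + 1 = k * 2 ^ n) := by
  have h4 (k : ℕ) : 4 ∣ k * 2 ^ n := (pow_dvd_pow 2 hn).mul_left k
  rw [padicValNat_two_sq_sub_one ha]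
  constructor
  · intro h
    rcases (by omega : a % 4 = 1 ∨ a % 4 = 3) with h4 | h4
    · have := padicValNat_two_eq_one (m := a + 1) (by omega)
      obtain ⟨k, hk, e⟩ := exists_odd_mul_two_pow (m := a - 1) (n := n) (by omega) (by omega)
      exact ⟨k, hk, Or.inl (by omega)⟩
    · have := padicValNat_two_eq_one (m := a - 1) (by omega)
      obtain ⟨k, hk, e⟩ := exists_odd_mul_two_pow (m := a + 1) (n := n) (by omega) (by omega)
      exact ⟨k, hk, Or.inr e⟩
  · rintro ⟨k, hk, e | e⟩
    · have := h4 k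
      rw [padicValNat_two_eq_one (m := a + 1) (by omega), show a - 1 = k * 2 ^ n by omega,
        padicValNat_two_mul_two_pow hk, add_comm]
    · have := h4 k
      rw [padicValNat_two_eq_one (m := a - 1) (by omega), e, padicValNat_two_mul_two_pow hk]

/-- Membership and minimality reduce to the odd multiples of `5` as soon as the candidate lies
below every base that is not divisible by `5`. -/
lemma isLeast_basesOfSpeed {n a : ℕ} (hn : 2 ≤ n) (h2 : ¬ 2 ∣ a) (h5 : 5 ∣ a)
    (hspeed : ∃ k, k % 2 = 1 ∧ (a = k * 2 ^ n + 1 ∨ a + 1 = k * 2 ^ n))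
    (hle : ∀ k c, k % 2 = 1 → 5 ∣ c → (c = k * 2 ^ n + 1 ∨ c + 1 = k * 2 ^ n) → a ≤ c)
    (hle' : ∀ c, 2 ≤ c → 5 ^ n ∣ c ^ 4 - 1 → a ≤ c) :
    IsLeast (basesOfSpeed n) a := by
  refine ⟨⟨by unfold Nat.ModEq; omega, isConstantCongruenceSpeed_of_five_dvd (by omega) h2 h5
    ((padicValNat_two_sq_sub_one_eq_iff hn (by omega) h2).2 hspeed)⟩, ?_⟩
  rintro c ⟨h10, hc⟩
  have hc2 : 2 ≤ c := by
    rcases hc with hc | hc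
    · omega
    · exact hc.1
  by_cases h5c : 5 ∣ c
  · have h2c : ¬ 2 ∣ c := by unfold Nat.ModEq at h10; omega
    obtain ⟨s, -, hs⟩ := exists_padicValNat_two hc2 h2c
    obtain rfl := hc.unique (isConstantCongruenceSpeed_of_five_dvd hc2 h2c h5c hs)
    obtain ⟨k, hk, e⟩ := (padicValNat_two_sq_sub_one_eq_iff hn hc2 h2c).1 hs
    exact hle k c hk h5c e
  · exact hle' c hc2 (five_pow_dvd_of_speed hc2 h5c hc)

lemma two_pow_mod_five (n : ℕ) : 2 ^ n % 5 = 2 ^ (n % 4) % 5 := by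
  conv_lhs => rw [← Nat.div_add_mod n 4, pow_add, pow_mul]
  rw [Nat.mul_mod, Nat.pow_mod]
  simp

/-- The odd multiples `k * 2 ^ n` with a neighbour divisible by `5` start at `k = 1` for even `n`,
where `2 ^ n ≡ ± 1` modulo `5`, and at `k = 3` for odd `n`, where `2 ^ n ≡ ± 2`. -/
lemma exists_isLeast_basesOfSpeed {n : ℕ} (hn : 2 ≤ n) :
    ∃ a, IsLeast (basesOfSpeed n) a ∧ a % 10 = 5 ∧
      (n % 4 = 0 ∧ a + 1 = 2 ^ n ∨ n % 4 = 1 ∧ a + 1 = 3 * 2 ^ n ∨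
        n % 4 = 2 ∧ a = 2 ^ n + 1 ∨ n % 4 = 3 ∧ a = 3 * 2 ^ n + 1) := by
  have h4 : 4 ∣ 2 ^ n := pow_dvd_pow 2 hn
  have hpos : 0 < 2 ^ n := by positivity
  have hmod := two_pow_mod_five n
  have hk (k : ℕ) (h : k % 2 = 1) : k = 1 ∨ k = 3 ∨ 5 * 2 ^ n ≤ k * 2 ^ n := by
    by_cases h5 : 5 ≤ k
    · exact Or.inr (Or.inr (Nat.mul_le_mul_right _ h5))
    · omega
  have hbig (c : ℕ) := two_pow_lt_of_five_pow_dvd (a := c) hn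
  have hbig' (c : ℕ) := three_mul_two_pow_lt_of_five_pow_dvd (a := c) hn
  rcases (by omega : n % 4 = 0 ∨ n % 4 = 1 ∨ n % 4 = 2 ∨ n % 4 = 3) with h | h | h | h <;>
    norm_num [h] at hmod
  · refine ⟨2 ^ n - 1, isLeast_basesOfSpeed hn (by omega) (by omega) ⟨1, by omega⟩ ?_ ?_,
      by omega, by omega⟩
    · intro k c hodd h5 hc
      rcases hk k hodd with rfl | rfl | _ <;> omega
    · intro c hc hd
      have := hbig c hc hd
      omega
  · refine ⟨3 * 2 ^ n - 1, isLeast_basesOfSpeed hn (by omega) (by omega) ⟨3, by omega⟩ ?_ ?_,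
      by omega, by omega⟩
    · intro k c hodd h5 hc
      rcases hk k hodd with rfl | rfl | _ <;> omega
    · intro c hc hd
      have := hbig' c (by omega) hc hd
      omega
  · refine ⟨2 ^ n + 1, isLeast_basesOfSpeed hn (by omega) (by omega) ⟨1, by omega⟩ ?_ ?_,
      by omega, by omega⟩
    · intro k c hodd h5 hc
      rcases hk k hodd with rfl | rfl | _ <;> omega
    · intro c hc hd
      have := hbig c hc hd
      omega
  · refine ⟨3 * 2 ^ n + 1, isLeast_basesOfSpeed hn (by omega) (by omega) ⟨3, by omega⟩ ?_ ?_,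
      by omega, by omega⟩
    · intro k c hodd h5 hc
      rcases hk k hodd with rfl | rfl | _ <;> omega
    · intro c hc hd
      have := hbig' c (by omega) hc hd
      omega

/-! ### The trigonometric form -/

lemma sin_cos_pi_mul_div_two (n : ℕ) :
    n % 4 = 0 ∧ Real.sin (Real.pi * n / 2) = 0 ∧ Real.cos (Real.pi * n / 2) = 1 ∨
    n % 4 = 1 ∧ Real.sin (Real.pi * n / 2) = 1 ∧ Real.cos (Real.pi * n / 2) = 0 ∨
    n % 4 = 2 ∧ Real.sin (Real.pi * n / 2) = 0 ∧ Real.cos (Real.pi * n / 2) = -1 ∨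
    n % 4 = 3 ∧ Real.sin (Real.pi * n / 2) = -1 ∧ Real.cos (Real.pi * n / 2) = 0 := by
  have e : Real.pi * n / 2 = Real.pi * (n % 4 : ℕ) / 2 + (n / 4 : ℕ) * (2 * Real.pi) := by
    have : (n : ℝ) = 4 * (n / 4 : ℕ) + (n % 4 : ℕ) := by exact_mod_cast (Nat.div_add_mod n 4).symm
    rw [this]
    ring
  rw [e, Real.sin_add_nat_mul_two_pi, Real.cos_add_nat_mul_two_pi]
  have h3 : Real.pi * 3 / 2 = Real.pi / 2 + Real.pi := by ring
  rcases (by omega : n % 4 = 0 ∨ n % 4 = 1 ∨ n % 4 = 2 ∨ n % 4 = 3) with h | h | h | h <;>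
    simp [h, h3, Real.sin_add_pi, Real.cos_add_pi]

theorem theorem1 :
    (∀ n : ℕ, 2 ≤ n → ∃ a : ℕ, IsLeast (basesOfSpeed n) a ∧ a ≡ 5 [MOD 10] ∧
      ((a : ℝ) = 2 ^ n * (5 + 2 * Real.sin (Real.pi * n / 2) + 4 * Real.cos (Real.pi * n / 2)) + 1
        ↔ n ≡ 2 [MOD 4] ∨ n ≡ 3 [MOD 4]) ∧
      ((a : ℝ) = 2 ^ n * (5 - 2 * Real.sin (Real.pi * n / 2) - 4 * Real.cos (Real.pi * n / 2)) - 1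
        ↔ n ≡ 0 [MOD 4] ∨ n ≡ 1 [MOD 4])) ∧
    IsLeast (basesOfSpeed 1) 2 ∧
    basesOfSpeed 0 = {1} ∧ IsLeast (basesOfSpeed 0) 1 := by
  have hzero : basesOfSpeed 0 = {1} := by
    ext a
    constructor
    · rintro ⟨h10, ha⟩
      rcases ha with ha | ha
      · exact ha.1
      · exact absurd rfl (IsConstantCongruenceSpeed.ne_zero ha.1 h10 (Or.inr ha))
    · rintro rfl
      exact ⟨by decide, Or.inl ⟨rfl, rfl⟩⟩
  refine ⟨fun n hn => ?_, ⟨⟨by decide, ?_⟩, ?_⟩, hzero, hzero ▸ isLeast_singleton⟩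
  · obtain ⟨a, hleast, ha, hval⟩ := exists_isLeast_basesOfSpeed hn
    refine ⟨a, hleast, ha, ?_⟩
    have hpow : (1 : ℝ) ≤ 2 ^ n := one_le_pow₀ (by norm_num)
    simp only [Nat.ModEq, Nat.reduceMod]
    rcases hval with ⟨h, e⟩ | ⟨h, e⟩ | ⟨h, e⟩ | ⟨h, e⟩ <;>
    · have e' := congrArg (Nat.cast (R := ℝ)) e
      push_cast at e'
      rcases sin_cos_pi_mul_div_two n with ⟨h', hs, hc⟩ | ⟨h', hs, hc⟩ | ⟨h', hs, hc⟩ |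
        ⟨h', hs, hc⟩ <;> first | (exfalso; omega) | skip
      rw [hs, hc, h]
      -- the formula of the wrong residue class has a different coefficient of `2 ^ n`
      constructor <;> norm_num <;> linarith
  · have h := isConstantCongruenceSpeed_of_two_dvd (a := 2) le_rfl (by norm_num) (by norm_num)
    have h1 : padicValNat 5 (2 ^ 4 - 1) = 1 := by
      rw [show 2 ^ 4 - 1 = 5 * 3 by norm_num, padicValNat.mul (by norm_num) (by norm_num),
        padicValNat.self (by norm_num), padicValNat.eq_zero_of_not_dvd (by norm_num)]
    rwa [h1] at h
  · rintro c ⟨-, hc | hc⟩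
    · omega
    · exact hc.1
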